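/- Let $\mathbb{F}=\mathbb{R}$ or $\mathbb{C}$, let $n\ge 0$, and equip $\mathbb{F}^n$ with its standard (Hermitian) inner product $\langle\cdot,\cdot\rangle$. Let $G^n$ be the set of all linear subspaces of $\mathbb{F}^n$ (of all dimensions), and let $P_W$ be the orthogonal projection onto $W\in G^n$. For $V,W\in G^n$ with $p=\dim V$ and $q=\dim W$, let $0\le\theta_1\le\theta_2\le\cdots\le\theta_{\min\{p,q\}}\le\frac{\pi}{2}$ be their principal angles, i.e. $\cos\theta_1\ge\cos\theta_2\ge\cdots$ are the $\min\{p,q\}$ largest singular values of the orthogonal projection $V\to W$. The asymmetric Fubini-Study metric is $$d_{FS}(V,W)=\begin{cases}\cos^{-1}\left(\prod_{i=1}^p\cos\theta_i\right) & \text{if } p\le q,\\ \frac{\pi}{2} & \text{if } p>q,\end{cases}$$ with the empty product equal to $1$. Say that $V$ is partially orthogonal to $W$ if $W^\perp\cap V\ne\{0\}$, and that vectors $x,y\in\mathbb{F}^n$ are aligned if $\langle x,y\rangle$ is real and $\ge 0$. Inclusions $\subset$ need not be strict, and $[x]$ denotes the span of $x$. **Proposition.** Let $U,V,W\in G^n$.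 Then $d_{FS}(V,W)=d_{FS}(V,U)+d_{FS}(U,W)$ if and only if at least one of the following holds: (i) $U\subset W$, and either $V$ is partially orthogonal to $W$ or $P_W(V)\subset U$; (ii) $V\subset U$, and either $V$ is partially orthogonal to $W$ or $V^\perp\cap U\subset W$; (iii) $V=[v]\oplus R$, $U=[u]\oplus S$ and $W=[w]\oplus T$ for some subspaces $R\subset S\subset T$ and some nonzero, pairwise aligned $u,v,w\in T^\perp$ with $u=\kappa v+\lambda w$ for real numbers $\kappa,\lambda>0$. -/

import Mathlib

noncomputable section

namespace TotalGrassmannian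

variable {𝕜 E : Type*} [RCLike 𝕜] [NormedAddCommGroup E] [InnerProductSpace 𝕜 E]
  [FiniteDimensional 𝕜 E]

/-- The orthogonal projection `V → W` between two subspaces of `E`. -/
def projMap (V W : Submodule 𝕜 E) : V →ₗ[𝕜] W :=
  (W.orthogonalProjectionOnto : E →ₗ[𝕜] W) ∘ₗ V.subtype

/-- The principal angles `θ₁ ≤ θ₂ ≤ ⋯` of `V` and `W`, numbered from `0`: their cosines are the
singular values (in decreasing order, with multiplicity) of the orthogonal projection `V → W`.
Only the indices `i < min (dim V) (dim W)` are meaningful. -/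
def principalAngle (V W : Submodule 𝕜 E) (i : ℕ) : ℝ :=
  Real.arccos ((projMap V W).singularValues i)

/-- The asymmetric Fubini-Study metric from `V` to `W`: with `p = dim V` and `q = dim W`, it is
`arccos (cos θ₁ ⋯ cos θ_p)` if `p ≤ q`, and `π / 2` otherwise. -/
def dFS (V W : Submodule 𝕜 E) : ℝ :=
  if Module.finrank 𝕜 V ≤ Module.finrank 𝕜 W then
    Real.arccos (∏ i ∈ Finset.range (Module.finrank 𝕜 V), Real.cos (principalAngle V W i))
  else Real.pi / 2

/-- `V` is partially orthogonal to `W` (an asymmetric relation). -/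
def PartiallyOrthogonal (V W : Submodule 𝕜 E) : Prop :=
  Wᗮ ⊓ V ≠ ⊥

/-- Two vectors are aligned if their (Hermitian) inner product is a nonnegative real number. -/
def Aligned (𝕜 : Type*) {E : Type*} [RCLike 𝕜] [NormedAddCommGroup E] [InnerProductSpace 𝕜 E]
    (u v : E) : Prop :=
  0 ≤ RCLike.re (inner 𝕜 u v) ∧ RCLike.im (inner 𝕜 u v) = 0

end TotalGrassmannian

end

open Module

/-! Represent a subspace V by the unit multivector A = a₁ ∧ ⋯ ∧ a_p of an orthonormal basis. The
cosine of `dFS V W` is then the volume factor ‖P_W A‖ (`cosFS_eq_norm_wedge`). It decreases when V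
grows and increases when W grows, and a distance vanishes exactly when the first space lies in the
second. So if U ⊂ W or V ⊂ U, additivity says that one of these monotonicities is an equality, which
gives (i) and (ii).

Otherwise both summands are positive. Put B = P_U A and C = P_W B. After normalisation A, B, C form
a path on the unit sphere, and additivity makes the spherical triangle inequality an equality, so B
= κA + λC with κ, λ > 0 (`wedge_relation`). Three decomposable multivectors so related, with the
spaces of A and B distinct, have a common factor of codimension one
(`finrank_inf_add_one_of_wedge_eq`). Dividing it out leaves u = κv + λw, which is (iii)
(`exists_aligned_of_dFS_eq_add`). Conversely, (iii) reduces to the addition of angles in a plane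
(`dFS_add_of_aligned`). -/

/-- Cauchy–Binet, with the sum over all maps `f` instead of increasing ones, hence the factorial.
Expand the first determinant over permutations; for fixed `σ`, multilinearity moves the sum over `f`
into the rows. The two signs of `σ` cancel. -/
theorem Matrix.sum_det_mul_det {R ι κ : Type*} [CommRing R] [Fintype ι] [DecidableEq ι]
    [Fintype κ] [DecidableEq κ] (A B : Matrix ι κ R) :
    ∑ f : ι → κ, (Matrix.of fun i j => A i (f j)).det * (Matrix.of fun i j => B i (f j)).det =
      (Fintype.card ι).factorial * (A * B.transpose).det := by
  have key (σ : Equiv.Perm ι) : ∑ f : ι → κ, (∏ j, A (σ j) (f j)) *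
      (Matrix.of fun i j => B i (f j)).det = Equiv.Perm.sign σ * (A * B.transpose).det := by
    have h1 (f : ι → κ) : (∏ j, A (σ j) (f j)) * (Matrix.of fun i j => B i (f j)).det =
        Matrix.detRowAlternating (fun j i => A (σ j) (f j) * B i (f j)) := by
      rw [← Matrix.det_mul_row, ← Matrix.det_transpose]
      rfl
    simp_rw [h1]
    have h2 := (Matrix.detRowAlternating (n := ι) (R := R)).toMultilinearMap.map_sum
      (fun (j : ι) (t : κ) (i : ι) => A (σ j) t * B i t)
    simp only [AlternatingMap.coe_multilinearMap] at h2
    rw [← h2, ← Matrix.det_permute]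
    show Matrix.det _ = _
    congr 1
    ext j i
    simp [Matrix.mul_apply, Finset.sum_apply]
  have hA (f : ι → κ) : (Matrix.of fun i j => A i (f j)).det =
      ∑ σ : Equiv.Perm ι, (Equiv.Perm.sign σ : R) * ∏ j, A (σ j) (f j) := Matrix.det_apply' _
  simp_rw [hA, Finset.sum_mul]
  rw [Finset.sum_comm]
  simp only [mul_assoc, ← Finset.mul_sum, key]
  have : ∀ σ : Equiv.Perm ι, ((Equiv.Perm.sign σ : ℤ) : R) * (((Equiv.Perm.sign σ : ℤ) : R) *
      (A * B.transpose).det) = (A * B.transpose).det := fun σ => by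
    rw [← mul_assoc, ← Int.cast_mul, ← Units.val_mul, Int.units_mul_self]; simp
  simp [this, Fintype.card_perm]

noncomputable section

namespace TotalGrassmannian

variable {𝕜 E : Type*} [RCLike 𝕜] [NormedAddCommGroup E] [InnerProductSpace 𝕜 E]
  [FiniteDimensional 𝕜 E]

/-! ### Decomposable multivectors and Gram determinants -/

/-- A model of the `k`-th exterior power of `E`, containing the decomposable multivectors as
their tuples of Plücker coordinates. -/
abbrev Multivector (𝕜 E : Type*) [RCLike 𝕜] [NormedAddCommGroup E] [InnerProductSpace 𝕜 E]
    (k : ℕ) : Type _ :=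
  EuclideanSpace 𝕜 (Fin k → Fin (finrank 𝕜 E))

/-- The decomposable multivector `x 0 ∧ x 1 ∧ ⋯`, normalised so that inner products are
Gram determinants. -/
def wedge (𝕜 : Type*) {E : Type*} [RCLike 𝕜] [NormedAddCommGroup E] [InnerProductSpace 𝕜 E]
    [FiniteDimensional 𝕜 E] (k : ℕ) : E [⋀^Fin k]→ₗ[𝕜] Multivector 𝕜 E k :=
  ((WithLp.linearEquiv 2 𝕜 ((Fin k → Fin (finrank 𝕜 E)) → 𝕜)).symm :
    ((Fin k → Fin (finrank 𝕜 E)) → 𝕜) →ₗ[𝕜] Multivector 𝕜 E k).compAlternatingMap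
    (AlternatingMap.pi fun f : Fin k → Fin (finrank 𝕜 E) =>
      (((√(k.factorial : ℝ))⁻¹ : ℝ) : 𝕜) • Matrix.detRowAlternating.compLinearMap
        (LinearMap.pi fun j => ((stdOrthonormalBasis 𝕜 E).toBasis.coord (f j))))

theorem wedge_apply {k : ℕ} (x : Fin k → E) (f : Fin k → Fin (finrank 𝕜 E)) :
    wedge 𝕜 k x f = (((√(k.factorial : ℝ))⁻¹ : ℝ) : 𝕜) *
      (Matrix.of fun i j => inner 𝕜 (stdOrthonormalBasis 𝕜 E (f j)) (x i)).det := by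
  have h : (fun i => (LinearMap.pi fun j => (stdOrthonormalBasis 𝕜 E).toBasis.coord (f j)) (x i)) =
      Matrix.of fun i j => inner 𝕜 (stdOrthonormalBasis 𝕜 E (f j)) (x i) := by
    ext i j
    simp [OrthonormalBasis.repr_apply_apply]
  rw [← h]
  rfl

/-- Cauchy–Binet followed by Parseval; the two factors 1/√k! absorb the factorial. -/
theorem inner_wedge {k : ℕ} (x y : Fin k → E) :
    inner 𝕜 (wedge 𝕜 k x) (wedge 𝕜 k y) = (Matrix.of fun i j => inner 𝕜 (x i) (y j)).det := by
  have h := Matrix.sum_det_mul_det (R := 𝕜)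
    (fun (i : Fin k) t => inner 𝕜 (x i) (stdOrthonormalBasis 𝕜 E t))
    (fun i t => inner 𝕜 (stdOrthonormalBasis 𝕜 E t) (y i))
  have h3 (f : Fin k → Fin (finrank 𝕜 E)) : inner 𝕜 (wedge 𝕜 k x f) (wedge 𝕜 k y f) =
      ((k.factorial : 𝕜))⁻¹ * ((Matrix.of fun i j => inner 𝕜 (x i) (stdOrthonormalBasis 𝕜 E (f j))).det *
      (Matrix.of fun i j => inner 𝕜 (stdOrthonormalBasis 𝕜 E (f j)) (y i)).det) := by
    have h4 : (Matrix.of fun i j => inner 𝕜 (x i) (stdOrthonormalBasis 𝕜 E (f j))).det =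
      (starRingEnd 𝕜) (Matrix.of fun i j => inner 𝕜 (stdOrthonormalBasis 𝕜 E (f j)) (x i)).det := by
      rw [RingHom.map_det]
      congr 1
      ext i j
      simp
    have h5 : (k.factorial : 𝕜)⁻¹ = (((√(k.factorial : ℝ))⁻¹ : ℝ) : 𝕜) *
        (((√(k.factorial : ℝ))⁻¹ : ℝ) : 𝕜) := by
      rw [← RCLike.ofReal_mul, ← mul_inv, Real.mul_self_sqrt (by positivity)]
      simp
    rw [RCLike.inner_apply, wedge_apply, wedge_apply, h4, h5]
    simp only [map_mul, RCLike.conj_ofReal]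
    ring
  rw [PiLp.inner_apply]
  simp_rw [h3]
  rw [← Finset.mul_sum, h, Fintype.card_fin, inv_mul_cancel_left₀ (by exact_mod_cast k.factorial_ne_zero)]
  congr 1
  ext i j
  exact (stdOrthonormalBasis 𝕜 E).sum_inner_mul_inner (x i) (y j)

theorem norm_wedge_sq {k : ℕ} (x : Fin k → E) :
    ((‖wedge 𝕜 k x‖ ^ 2 : ℝ) : 𝕜) = (Matrix.gram 𝕜 x).det := by
  rw [RCLike.ofReal_pow, ← inner_self_eq_norm_sq_to_K, inner_wedge]
  rfl

theorem wedge_ne_zero_iff {k : ℕ} {x : Fin k → E} :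
    wedge 𝕜 k x ≠ 0 ↔ LinearIndependent 𝕜 x := by
  rw [← Matrix.det_gram_ne_zero_iff_linearIndependent, ← norm_wedge_sq]
  simp

theorem norm_wedge_of_orthonormal {k : ℕ} {x : Fin k → E} (hx : Orthonormal 𝕜 x) :
    ‖wedge 𝕜 k x‖ = 1 := by
  have h := norm_wedge_sq (𝕜 := 𝕜) x
  rw [Matrix.gram_eq_one_iff_orthonormal.2 hx, Matrix.det_one, ← RCLike.ofReal_one,
    RCLike.ofReal_inj] at h
  nlinarith [norm_nonneg (wedge 𝕜 k x)]

/-- Exterior multiplication by a vector is linear. -/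
theorem exists_wedge_cons (z : E) (k : ℕ) :
    ∃ L : Multivector 𝕜 E k →ₗ[𝕜] Multivector 𝕜 E (k + 1),
      ∀ x : Fin k → E, wedge 𝕜 (k + 1) (Matrix.vecCons z x) = L (wedge 𝕜 k x) := by
  -- Laplace expansion along the row of `z`; the scalar converts between the normalisations in
  -- degrees `k` and `k + 1`.
  refine ⟨{ toFun := fun h => WithLp.toLp 2 fun g =>
              (((√((k + 1).factorial : ℝ))⁻¹ * √(k.factorial : ℝ) : ℝ) : 𝕜) *
              ∑ j : Fin (k + 1), (-1) ^ (j : ℕ) * inner 𝕜 (stdOrthonormalBasis 𝕜 E (g j)) z *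
                h fun i => g (j.succAbove i)
            map_add' := fun h h' => ?_
            map_smul' := fun c h => ?_ }, fun x => ?_⟩
  · ext g
    simp [mul_add, Finset.sum_add_distrib]
  · ext g
    simp only [PiLp.smul_apply, smul_eq_mul, Finset.mul_sum, RingHom.id_apply]
    exact Finset.sum_congr rfl fun _ _ => by ring
  · ext g
    rw [wedge_apply, Matrix.det_succ_row_zero]
    simp only [LinearMap.coe_mk, AddHom.coe_mk, wedge_apply, Finset.mul_sum]
    refine Finset.sum_congr rfl fun j _ => ?_
    have h : ((√(k.factorial : ℝ) : ℝ) : 𝕜) * (((√(k.factorial : ℝ))⁻¹ : ℝ) : 𝕜) = 1 := by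
      rw [← RCLike.ofReal_mul, mul_inv_cancel₀ (by positivity), RCLike.ofReal_one]
    rw [RCLike.ofReal_mul]
    have h2 : ((Matrix.of fun i j => inner 𝕜 (stdOrthonormalBasis 𝕜 E (g j))
        (Matrix.vecCons z x i)).submatrix Fin.succ j.succAbove).det =
        (Matrix.of fun i i' => inner 𝕜 (stdOrthonormalBasis 𝕜 E (g (j.succAbove i')))
          (x i)).det := rfl
    rw [h2]
    simp only [Matrix.of_apply, Matrix.cons_val_zero]
    linear_combination (-(((√((k + 1).factorial : ℝ))⁻¹ : ℝ) : 𝕜) * (-1) ^ (j : ℕ) *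
      inner 𝕜 (stdOrthonormalBasis 𝕜 E (g j)) z *
      (Matrix.of fun i i' => inner 𝕜 (stdOrthonormalBasis 𝕜 E (g (j.succAbove i')))
          (x i)).det) * h

/-- Removing from the first vector its component along the others. -/
theorem wedge_cons_add {k : ℕ} {y z : E} {x : Fin k → E}
    (hz : z ∈ Submodule.span 𝕜 (Set.range x)) :
    wedge 𝕜 (k + 1) (Matrix.vecCons (y + z) x) = wedge 𝕜 (k + 1) (Matrix.vecCons y x) := by
  have h := (wedge 𝕜 (E := E) (k + 1)).map_update_add (Matrix.vecCons 0 x) 0 y z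
  have h2 (t : E) : Function.update (Matrix.vecCons 0 x) 0 t = Matrix.vecCons t x := by
    ext i; refine Fin.cases ?_ (fun i => ?_) i <;> simp
  simp only [h2] at h
  rw [h, add_eq_left, ← not_ne_iff, wedge_ne_zero_iff]
  exact fun hl => (linearIndependent_finCons.1 hl).2 hz

theorem inner_wedge_cons {k : ℕ} {y : E} (z : E) {x : Fin k → E}
    (h : ∀ i, inner 𝕜 y (x i) = 0) :
    inner 𝕜 (wedge 𝕜 (k + 1) (Matrix.vecCons y x)) (wedge 𝕜 (k + 1) (Matrix.vecCons z x)) =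
      inner 𝕜 y z * ((‖wedge 𝕜 k x‖ ^ 2 : ℝ) : 𝕜) := by
  rw [inner_wedge, norm_wedge_sq, Matrix.det_succ_row_zero, Fin.sum_univ_succ]
  have h2 : (Matrix.of fun i j => inner 𝕜 (Matrix.vecCons y x i)
      (Matrix.vecCons z x j)).submatrix Fin.succ (Fin.succAbove 0) = Matrix.gram 𝕜 x := rfl
  rw [h2]
  simp [h]

theorem norm_wedge_cons {k : ℕ} {y : E} {x : Fin k → E} (h : ∀ i, inner 𝕜 y (x i) = 0) :
    ‖wedge 𝕜 (k + 1) (Matrix.vecCons y x)‖ = ‖y‖ * ‖wedge 𝕜 k x‖ := by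
  have h1 := inner_wedge_cons y h
  rw [inner_self_eq_norm_sq_to_K, inner_self_eq_norm_sq_to_K, ← RCLike.ofReal_pow,
    ← RCLike.ofReal_pow, ← RCLike.ofReal_mul, RCLike.ofReal_inj, ← mul_pow] at h1
  exact (sq_eq_sq₀ (norm_nonneg _) (by positivity)).1 h1

/-- Exterior multiplication by `x i` kills the left side, but would not kill the right side if `x i`
were outside the span of `y`. -/
theorem span_le_span_of_wedge_eq_smul {k : ℕ} {x y : Fin k → E} {t : 𝕜}
    (h : wedge 𝕜 k x = t • wedge 𝕜 k y) (hx : wedge 𝕜 k x ≠ 0) :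
    Submodule.span 𝕜 (Set.range x) ≤ Submodule.span 𝕜 (Set.range y) := by
  rw [Submodule.span_le]
  rintro _ ⟨i, rfl⟩
  by_contra hi
  have hy : wedge 𝕜 k y ≠ 0 := fun h0 => hx (by rw [h, h0, smul_zero])
  obtain ⟨L, hL⟩ := exists_wedge_cons (𝕜 := 𝕜) (x i) k
  have h1 : wedge 𝕜 (k + 1) (Matrix.vecCons (x i) y) ≠ 0 :=
    wedge_ne_zero_iff.2 (linearIndependent_finCons.2 ⟨wedge_ne_zero_iff.1 hy, hi⟩)
  have h2 : wedge 𝕜 (k + 1) (Matrix.vecCons (x i) x) = 0 :=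
    (wedge 𝕜 (k + 1)).map_eq_zero_of_eq _ (i := 0) (j := i.succ) (by simp)
      (Fin.succ_ne_zero i).symm
  have ht : t ≠ 0 := fun h0 => hx (by rw [h, h0, zero_smul])
  rw [hL, h, map_smul, ← hL] at h2
  exact (smul_ne_zero ht h1) h2

theorem span_eq_span_of_wedge_eq_smul {k : ℕ} {x y : Fin k → E} {t : 𝕜}
    (h : wedge 𝕜 k x = t • wedge 𝕜 k y) (hx : wedge 𝕜 k x ≠ 0) :
    Submodule.span 𝕜 (Set.range x) = Submodule.span 𝕜 (Set.range y) := by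
  have ht : t ≠ 0 := fun h0 => hx (by rw [h, h0, zero_smul])
  have hy : wedge 𝕜 k y ≠ 0 := fun h0 => hx (by rw [h, h0, smul_zero])
  exact (span_le_span_of_wedge_eq_smul h hx).antisymm
    (span_le_span_of_wedge_eq_smul (t := t⁻¹) (by rw [h, inv_smul_smul₀ ht]) hy)

/-- The determinant of a change of basis relates the multivectors of all linear images. -/
theorem exists_wedge_map_eq_smul {k : ℕ} {x y : Fin k → E}
    (hy : LinearIndependent 𝕜 y)
    (h : ∀ i, x i ∈ Submodule.span 𝕜 (Set.range y)) :
    ∃ t : 𝕜, ∀ A : E →ₗ[𝕜] E,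
      wedge 𝕜 k (fun i => A (x i)) = t • wedge 𝕜 k fun i => A (y i) := by
  let b := Basis.span hy
  let x' : Fin k → Submodule.span 𝕜 (Set.range y) := fun i => ⟨x i, h i⟩
  refine ⟨b.det x', fun A => ?_⟩
  ext f
  let F : Submodule.span 𝕜 (Set.range y) [⋀^Fin k]→ₗ[𝕜] 𝕜 :=
    (((EuclideanSpace.proj f : Multivector 𝕜 E k →L[𝕜] 𝕜) :
      Multivector 𝕜 E k →ₗ[𝕜] 𝕜).compAlternatingMap (wedge 𝕜 k)).compLinearMap
      (A ∘ₗ Submodule.subtype _)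
  have h1 := DFunLike.congr_fun (F.eq_smul_basis_det b) x'
  have h2 : F x' = wedge 𝕜 k (fun i => A (x i)) f := rfl
  have h3 : F b = wedge 𝕜 k (fun i => A (y i)) f := by
    show wedge 𝕜 k (fun i => A ((b i : Submodule.span 𝕜 (Set.range y)) : E)) f = _
    have h4 : (fun i => A ((b i : Submodule.span 𝕜 (Set.range y)) : E)) = fun i => A (y i) :=
      funext fun i => congrArg (fun z : Submodule.span 𝕜 (Set.range y) => A z)
        (Basis.span_apply hy i)
    rw [h4]
  rw [h2, AlternatingMap.smul_apply, h3] at h1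
  rw [h1, PiLp.smul_apply, smul_eq_mul, smul_eq_mul, mul_comm]

theorem exists_wedge_eq_smul {k : ℕ} {x y : Fin k → E}
    (hy : LinearIndependent 𝕜 y)
    (h : ∀ i, x i ∈ Submodule.span 𝕜 (Set.range y)) :
    ∃ t : 𝕜, wedge 𝕜 k x = t • wedge 𝕜 k y :=
  let ⟨t, ht⟩ := exists_wedge_map_eq_smul hy h
  ⟨t, ht LinearMap.id⟩

/-! ### The Fubini-Study cosine as a volume factor -/

/-- The cosine of the asymmetric Fubini-Study metric: the factor by which the orthogonal
projection `V → W` contracts volumes. -/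
def cosFS (V W : Submodule 𝕜 E) : ℝ := (projMap V W).normDet

theorem norm_projMap_le (V W : Submodule 𝕜 E) (x : V) : ‖projMap V W x‖ ≤ ‖x‖ :=
  W.norm_orthogonalProjectionOnto_apply_le x

theorem singularValues_projMap_le_one (V W : Submodule 𝕜 E) (i : ℕ) :
    (projMap V W).singularValues i ≤ 1 := by
  rcases lt_or_ge i (finrank 𝕜 V) with hi | hi
  · obtain ⟨x, hx⟩ :=
      ((projMap V W).hasEigenvalue_adjoint_comp_self_sq_singularValues hi).exists_hasEigenvector
    have h1 := hx.apply_eq_smul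
    have h2 : ((‖projMap V W x‖ ^ 2 : ℝ) : 𝕜) =
        (((projMap V W).singularValues i ^ 2 * ‖x‖ ^ 2 : ℝ) : 𝕜) := by
      rw [RCLike.ofReal_pow, ← inner_self_eq_norm_sq_to_K, ← LinearMap.adjoint_inner_right]
      rw [LinearMap.comp_apply] at h1
      rw [h1, inner_smul_right, inner_self_eq_norm_sq_to_K]
      push_cast
      rfl
    rw [RCLike.ofReal_inj] at h2
    have h3 := norm_projMap_le V W x
    have h4 : 0 < ‖x‖ := norm_pos_iff.2 hx.2
    have h5 := (projMap V W).singularValues_nonneg i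
    have h6 : (projMap V W).singularValues i ^ 2 * ‖x‖ ^ 2 ≤ 1 * ‖x‖ ^ 2 := by
      rw [← h2, one_mul]; gcongr
    have h7 := le_of_mul_le_mul_right h6 (by positivity)
    nlinarith
  · rw [LinearMap.singularValues_of_finrank_le _ hi]
    exact zero_le_one

theorem cosFS_nonneg (V W : Submodule 𝕜 E) : 0 ≤ cosFS V W := LinearMap.normDet_nonneg _

theorem cosFS_eq_prod (V W : Submodule 𝕜 E) : cosFS V W =
    ∏ i ∈ Finset.range (finrank 𝕜 V), (projMap V W).singularValues i :=
  LinearMap.normDet_eq_prod_singularValues _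

theorem cosFS_le_one (V W : Submodule 𝕜 E) : cosFS V W ≤ 1 := by
  rw [cosFS_eq_prod]
  exact Finset.prod_le_one (fun i _ => LinearMap.singularValues_nonneg _ i)
    fun i _ => singularValues_projMap_le_one V W i

/-- The case distinction disappears: if dim V > dim W the projection is not injective, its volume
factor is 0, and arccos 0 = π/2. -/
theorem dFS_eq_arccos (V W : Submodule 𝕜 E) : dFS V W = Real.arccos (cosFS V W) := by
  unfold dFS
  split_ifs with h
  · rw [cosFS_eq_prod]
    congr 1
    refine Finset.prod_congr rfl fun i _ => Real.cos_arccos ?_ (singularValues_projMap_le_one V W i)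
    linarith [(projMap V W).singularValues_nonneg i]
  · have h0 : cosFS V W = 0 := by
      rw [cosFS, LinearMap.normDet_eq_zero_iff_rank_range_ne]
      have := (LinearMap.range (projMap V W)).finrank_le
      omega
    rw [h0, Real.arccos_zero]

theorem projMap_eq_zero_iff {V W : Submodule 𝕜 E} {x : V} :
    projMap V W x = 0 ↔ (x : E) ∈ Wᗮ := by
  rw [← Submodule.orthogonalProjectionOnto_eq_zero_iff]
  rfl

theorem cosFS_eq_zero_iff {V W : Submodule 𝕜 E} : cosFS V W = 0 ↔ PartiallyOrthogonal V W := by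
  rw [cosFS, LinearMap.normDet_eq_zero_iff_ker_ne_bot, PartiallyOrthogonal, not_iff_not,
    Submodule.eq_bot_iff, Submodule.eq_bot_iff]
  constructor
  · rintro h x ⟨hx1, hx2⟩
    exact congrArg Subtype.val
      (h ⟨x, hx2⟩ (LinearMap.mem_ker.2 (projMap_eq_zero_iff.2 hx1)))
  · rintro h ⟨x, hx⟩ hk
    exact Subtype.ext (h x ⟨projMap_eq_zero_iff.1 (LinearMap.mem_ker.1 hk), hx⟩)

theorem exists_orthonormal_span_eq (V : Submodule 𝕜 E) :
    ∃ a : Fin (finrank 𝕜 V) → E, Orthonormal 𝕜 a ∧ Submodule.span 𝕜 (Set.range a) = V := by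
  refine ⟨fun i => stdOrthonormalBasis 𝕜 V i, ?_, ?_⟩
  · exact (stdOrthonormalBasis 𝕜 V).orthonormal.comp_linearIsometry V.subtypeₗᵢ
  · have h := (stdOrthonormalBasis 𝕜 V).toBasis.span_eq
    have h2 := congrArg (Submodule.map V.subtype) h
    rw [Submodule.map_span, ← Set.range_comp, Submodule.map_top, Submodule.range_subtype] at h2
    simpa [Function.comp_def] using h2

theorem exists_orthonormal_span_eq_of_finrank {V : Submodule 𝕜 E} {k : ℕ}
    (hk : finrank 𝕜 V = k) :
    ∃ a : Fin k → E, Orthonormal 𝕜 a ∧ Submodule.span 𝕜 (Set.range a) = V := by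
  subst hk
  exact exists_orthonormal_span_eq V

/-- Both squares are the Gram determinant of the projected orthonormal basis. -/
theorem cosFS_eq_norm_wedge {k : ℕ} {a : Fin k → E} (ha : Orthonormal 𝕜 a) {V : Submodule 𝕜 E}
    (hV : Submodule.span 𝕜 (Set.range a) = V) (W : Submodule 𝕜 E) :
    cosFS V W = ‖wedge 𝕜 k fun i => W.starProjection (a i)‖ := by
  subst hV
  let b₀ := Basis.span ha.linearIndependent
  have hb₀ (i : Fin k) : (b₀ i : E) = a i :=
    congrArg Subtype.val (Basis.span_apply ha.linearIndependent i)
  have hb : Orthonormal 𝕜 b₀ := by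
    rw [← (Submodule.subtypeₗᵢ _).orthonormal_comp_iff]
    have h : (Submodule.subtypeₗᵢ _) ∘ b₀ = a := funext hb₀
    rwa [h]
  have h := (projMap (Submodule.span 𝕜 (Set.range a)) W).normDet_sq_eq_det_gram
    (b₀.toOrthonormalBasis hb)
  have h2 : Matrix.gram 𝕜 (fun i => projMap (Submodule.span 𝕜 (Set.range a)) W
      (b₀.toOrthonormalBasis hb i)) = Matrix.gram 𝕜 fun i => W.starProjection (a i) := by
    ext i j
    rw [Matrix.gram_apply, Matrix.gram_apply, Basis.coe_toOrthonormalBasis, ← hb₀ i, ← hb₀ j]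
    rfl
  rw [h2, ← norm_wedge_sq, RCLike.ofReal_inj] at h
  exact (sq_eq_sq₀ (cosFS_nonneg _ _) (norm_nonneg _)).1 h

/-! ### Monotonicity in each argument and its equality cases -/

theorem starProjection_vecCons {k : ℕ} (W : Submodule 𝕜 E) (y : E) (a : Fin k → E) :
    (fun i => W.starProjection (Matrix.vecCons y a i)) =
      Matrix.vecCons (W.starProjection y) fun i => W.starProjection (a i) := by
  ext1 i
  refine Fin.cases ?_ (fun i => ?_) i <;> simp

omit [FiniteDimensional 𝕜 E] in
theorem span_range_vecCons {k : ℕ} (y : E) (a : Fin k → E) :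
    Submodule.span 𝕜 (Set.range (Matrix.vecCons y a)) =
      Submodule.span 𝕜 {y} ⊔ Submodule.span 𝕜 (Set.range a) := by
  rw [← Submodule.span_union]
  congr 1
  exact Fin.range_cons y a

theorem inner_starProjection_starProjection (W : Submodule 𝕜 E) (x y : E) :
    inner 𝕜 (W.starProjection x) (W.starProjection y) = inner 𝕜 (W.starProjection x) y := by
  rw [← Submodule.inner_starProjection_left_eq_right,
    Submodule.starProjection_eq_self_iff.2 (Submodule.starProjection_apply_mem _ _)]

theorem exists_vecCons_orthonormal {V : Submodule 𝕜 E} {y : E} (hy : ‖y‖ = 1) (hyV : y ∈ Vᗮ) :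
    ∃ a : Fin (finrank 𝕜 V) → E, Orthonormal 𝕜 a ∧ Submodule.span 𝕜 (Set.range a) = V ∧
      Orthonormal 𝕜 (Matrix.vecCons y a) ∧
      Submodule.span 𝕜 (Set.range (Matrix.vecCons y a)) = Submodule.span 𝕜 {y} ⊔ V := by
  obtain ⟨a, ha, hV⟩ := exists_orthonormal_span_eq V
  refine ⟨a, ha, hV, orthonormal_vecCons_iff.2 ⟨hy, fun i => ?_, ha⟩, by
    rw [span_range_vecCons, hV]⟩
  exact (Submodule.mem_orthogonal' V y).1 hyV _ (hV ▸ Submodule.subset_span ⟨i, rfl⟩)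

/-- Only the component of P_W y orthogonal to P_W(V) contributes to the volume, and it is no longer
than P_W y. -/
theorem cosFS_span_singleton_sup_le {V W : Submodule 𝕜 E} {y : E} (hy : ‖y‖ = 1) (hyV : y ∈ Vᗮ) :
    cosFS (Submodule.span 𝕜 {y} ⊔ V) W ≤ ‖W.starProjection y‖ * cosFS V W := by
  obtain ⟨a, ha, hV, ha', hV'⟩ := exists_vecCons_orthonormal hy hyV
  rw [cosFS_eq_norm_wedge ha' hV', cosFS_eq_norm_wedge ha hV, starProjection_vecCons]
  set x := fun i => W.starProjection (a i) with hx
  set Q := Submodule.span 𝕜 (Set.range x)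
  have h : W.starProjection y = Qᗮ.starProjection (W.starProjection y) +
      Q.starProjection (W.starProjection y) := by
    rw [add_comm, Submodule.starProjection_add_starProjection_orthogonal]
  nth_rw 1 [h]
  rw [wedge_cons_add (Submodule.starProjection_apply_mem _ _), norm_wedge_cons]
  · gcongr
    exact Submodule.norm_starProjection_apply_le _ _
  · exact fun i => (Submodule.mem_orthogonal' Q _).1 (Submodule.starProjection_apply_mem _ _) _
      (Submodule.subset_span ⟨i, rfl⟩)

theorem cosFS_span_singleton_sup {V W : Submodule 𝕜 E} {y : E} (hy : ‖y‖ = 1) (hyV : y ∈ Vᗮ)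
    (h : W.starProjection y ∈ Vᗮ) :
    cosFS (Submodule.span 𝕜 {y} ⊔ V) W = ‖W.starProjection y‖ * cosFS V W := by
  obtain ⟨a, ha, hV, ha', hV'⟩ := exists_vecCons_orthonormal hy hyV
  rw [cosFS_eq_norm_wedge ha' hV', cosFS_eq_norm_wedge ha hV, starProjection_vecCons,
    norm_wedge_cons]
  intro i
  rw [inner_starProjection_starProjection]
  exact (Submodule.mem_orthogonal' V _).1 h _ (hV ▸ Submodule.subset_span ⟨i, rfl⟩)

theorem cosFS_of_le {V W : Submodule 𝕜 E} (h : V ≤ W) : cosFS V W = 1 := by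
  obtain ⟨a, ha, hV⟩ := exists_orthonormal_span_eq V
  have h1 : (fun i => W.starProjection (a i)) = a := funext fun i =>
    Submodule.starProjection_eq_self_iff.2 (h (hV ▸ Submodule.subset_span ⟨i, rfl⟩))
  rw [cosFS_eq_norm_wedge ha hV, h1, norm_wedge_of_orthonormal ha]

theorem exists_unit_mem_orthogonal {V U : Submodule 𝕜 E} (h : V < U) :
    ∃ y, ‖y‖ = 1 ∧ y ∈ Vᗮ ∧ y ∈ U := by
  obtain ⟨x, hxU, hxV⟩ := SetLike.exists_of_lt h
  set z := x - V.starProjection x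
  have hz : z ≠ 0 := fun h0 => hxV
    (Submodule.starProjection_eq_self_iff.1 (sub_eq_zero.1 h0).symm)
  refine ⟨((‖z‖⁻¹ : ℝ) : 𝕜) • z, ?_, Submodule.smul_mem _ _
    (Submodule.sub_starProjection_mem_orthogonal x), Submodule.smul_mem _ _
    (U.sub_mem hxU (h.le (Submodule.starProjection_apply_mem _ _)))⟩
  rw [norm_smul, RCLike.norm_ofReal, abs_of_nonneg (by positivity),
    inv_mul_cancel₀ (norm_ne_zero_iff.2 hz)]

theorem cosFS_anti_left {V U : Submodule 𝕜 E} (W : Submodule 𝕜 E) (h : V ≤ U) :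
    cosFS U W ≤ cosFS V W := by
  -- `V` is enlarged towards `U` by one unit vector at a time; each step multiplies the cosine by at
  -- most ‖P_W y‖ ≤ 1.
  induction V using WellFoundedGT.induction with
  | ind V ih =>
    rcases h.eq_or_lt with rfl | hlt
    · exact le_rfl
    · obtain ⟨y, hy, hyV, hyU⟩ := exists_unit_mem_orthogonal hlt
      have h1 : V < Submodule.span 𝕜 {y} ⊔ V := by
        refine lt_of_le_of_ne le_sup_right fun h0 => ?_
        have h2 : y ∈ V := h0 ▸ Submodule.mem_sup_left (Submodule.mem_span_singleton_self y)
        have h3 := (Submodule.mem_orthogonal V y).1 hyV y h2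
        rw [inner_self_eq_zero] at h3
        simp [h3] at hy
      refine (ih _ h1 (sup_le (by simpa using hyU) h)).trans
        ((cosFS_span_singleton_sup_le hy hyV).trans ?_)
      have h4 := W.norm_starProjection_apply_le y
      rw [hy] at h4
      exact mul_le_of_le_one_left (cosFS_nonneg _ _) h4

theorem cosFS_eq_of_orthogonal_inf_le {V U W : Submodule 𝕜 E} (h : V ≤ U) (hW : Vᗮ ⊓ U ≤ W) :
    cosFS U W = cosFS V W := by
  induction V using WellFoundedGT.induction with
  | ind V ih =>
    rcases h.eq_or_lt with rfl | hlt
    · rfl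
    · obtain ⟨y, hy, hyV, hyU⟩ := exists_unit_mem_orthogonal hlt
      have h1 : V < Submodule.span 𝕜 {y} ⊔ V := by
        refine lt_of_le_of_ne le_sup_right fun h0 => ?_
        have h2 : y ∈ V := h0 ▸ Submodule.mem_sup_left (Submodule.mem_span_singleton_self y)
        have h3 := (Submodule.mem_orthogonal V y).1 hyV y h2
        rw [inner_self_eq_zero] at h3
        simp [h3] at hy
      have h2 : W.starProjection y = y := Submodule.starProjection_eq_self_iff.2 (hW ⟨hyV, hyU⟩)
      rw [ih _ h1 (sup_le (by simpa using hyU) h)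
        ((inf_le_inf_right U (Submodule.orthogonal_le le_sup_right)).trans hW),
        cosFS_span_singleton_sup hy hyV (by rwa [h2]), h2, hy, one_mul]

/-- For a unit vector y in Vᗮ ∩ U, the cosine for [y] ⊕ V lies between two equal nonzero values, and
is at most ‖P_W y‖ times that value. Hence ‖P_W y‖ = 1. -/
theorem orthogonal_inf_le_of_cosFS_eq {V U W : Submodule 𝕜 E} (h : V ≤ U)
    (h0 : cosFS V W ≠ 0) (heq : cosFS U W = cosFS V W) : Vᗮ ⊓ U ≤ W := by
  rintro x ⟨hxV, hxU⟩
  by_cases hx : x = 0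
  · rw [hx]; exact W.zero_mem
  have hx' : ‖x‖ ≠ 0 := norm_ne_zero_iff.2 hx
  set y := ((‖x‖⁻¹ : ℝ) : 𝕜) • x with hy_def
  have hy : ‖y‖ = 1 := by
    rw [norm_smul, RCLike.norm_ofReal, abs_of_nonneg (by positivity), inv_mul_cancel₀ hx']
  have hyV : y ∈ Vᗮ := Submodule.smul_mem _ _ hxV
  have hyU : y ∈ U := Submodule.smul_mem _ _ hxU
  have h1 := (cosFS_anti_left W (sup_le ((Submodule.span_singleton_le_iff_mem y U).2 hyU) h)).trans
    (cosFS_span_singleton_sup_le hy hyV)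
  rw [heq] at h1
  have h2 : 0 < cosFS V W := lt_of_le_of_ne (cosFS_nonneg _ _) h0.symm
  have h3 : 1 ≤ ‖W.starProjection y‖ := by nlinarith
  have h4 : y ∈ W := (Submodule.mem_iff_norm_starProjection W y).2
    (le_antisymm (by rwa [hy]) (W.norm_starProjection_apply_le y)).symm
  have h5 : x = ((‖x‖ : ℝ) : 𝕜) • y := by
    rw [hy_def, smul_smul, ← RCLike.ofReal_mul, mul_inv_cancel₀ hx', RCLike.ofReal_one, one_smul]
  rw [h5]
  exact W.smul_mem _ h4

theorem le_of_cosFS_eq_one {U W : Submodule 𝕜 E} (h : cosFS U W = 1) : U ≤ W := by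
  have h1 : cosFS (⊥ : Submodule 𝕜 E) W = 1 := cosFS_of_le bot_le
  have := orthogonal_inf_le_of_cosFS_eq (V := ⊥) (U := U) (W := W) bot_le (by simp [h1])
    (h.trans h1.symm)
  simpa using this

/-- The projection to `U` of the projection to `W ⊇ U` loses volume orthogonally. -/
theorem norm_wedge_sub_sq {k : ℕ} (a : Fin k → E) {U W : Submodule 𝕜 E} (h : U ≤ W) :
    ‖wedge 𝕜 k (fun i => W.starProjection (a i)) - wedge 𝕜 k (fun i => U.starProjection (a i))‖ ^ 2
    = ‖wedge 𝕜 k fun i => W.starProjection (a i)‖ ^ 2 -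
      ‖wedge 𝕜 k fun i => U.starProjection (a i)‖ ^ 2 := by
  have h1 : inner 𝕜 (wedge 𝕜 k fun i => W.starProjection (a i))
      (wedge 𝕜 k fun i => U.starProjection (a i)) =
      inner 𝕜 (wedge 𝕜 k fun i => U.starProjection (a i))
      (wedge 𝕜 k fun i => U.starProjection (a i)) := by
    rw [inner_wedge, inner_wedge]
    congr 1
    ext i j
    simp only [Matrix.of_apply]
    rw [Submodule.inner_starProjection_left_eq_right, Submodule.starProjection_eq_self_iff.2
      (h (Submodule.starProjection_apply_mem _ _)), inner_starProjection_starProjection,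
      Submodule.inner_starProjection_left_eq_right]
  rw [norm_sub_sq (𝕜 := 𝕜), h1, inner_self_eq_norm_sq]
  ring

theorem cosFS_mono_right (V : Submodule 𝕜 E) {U W : Submodule 𝕜 E} (h : U ≤ W) :
    cosFS V U ≤ cosFS V W := by
  obtain ⟨a, ha, hV⟩ := exists_orthonormal_span_eq V
  rw [cosFS_eq_norm_wedge ha hV, cosFS_eq_norm_wedge ha hV]
  have := norm_wedge_sub_sq a h
  refine le_of_sq_le_sq ?_ (norm_nonneg _)
  nlinarith [sq_nonneg ‖wedge 𝕜 _ (fun i => W.starProjection (a i)) -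
    wedge 𝕜 _ (fun i => U.starProjection (a i))‖]

theorem map_starProjection_eq_span {k : ℕ} {a : Fin k → E} {V : Submodule 𝕜 E}
    (hV : Submodule.span 𝕜 (Set.range a) = V) (W : Submodule 𝕜 E) :
    V.map (W.starProjection : E →ₗ[𝕜] E) =
      Submodule.span 𝕜 (Set.range fun i => W.starProjection (a i)) := by
  rw [← hV, Submodule.map_span, ← Set.range_comp]
  rfl

/-- By the Pythagorean identity `norm_wedge_sub_sq`, equal norms force the two projected
multivectors to coincide, hence also their spans. -/
theorem map_starProjection_le_of_cosFS_eq {V U W : Submodule 𝕜 E} (h : U ≤ W)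
    (h0 : cosFS V W ≠ 0) (heq : cosFS V W = cosFS V U) :
    V.map (W.starProjection : E →ₗ[𝕜] E) ≤ U := by
  obtain ⟨a, ha, hV⟩ := exists_orthonormal_span_eq V
  rw [cosFS_eq_norm_wedge ha hV] at h0
  rw [cosFS_eq_norm_wedge ha hV, cosFS_eq_norm_wedge ha hV] at heq
  have h1 := norm_wedge_sub_sq a h
  rw [heq, sub_self, sq_eq_zero_iff, norm_eq_zero, sub_eq_zero] at h1
  rw [map_starProjection_eq_span hV]
  refine (span_le_span_of_wedge_eq_smul (t := 1) (h1.trans (one_smul 𝕜 _).symm)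
    (norm_ne_zero_iff.1 h0)).trans (Submodule.span_le.2 ?_)
  rintro _ ⟨i, rfl⟩
  exact Submodule.starProjection_apply_mem _ _

theorem cosFS_eq_of_map_starProjection_le {V U W : Submodule 𝕜 E} (h : U ≤ W)
    (hm : V.map (W.starProjection : E →ₗ[𝕜] E) ≤ U) : cosFS V W = cosFS V U := by
  obtain ⟨a, ha, hV⟩ := exists_orthonormal_span_eq V
  rw [cosFS_eq_norm_wedge ha hV, cosFS_eq_norm_wedge ha hV]
  have h1 : (fun i => W.starProjection (a i)) = fun i => U.starProjection (a i) := by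
    ext1 i
    have h2 : W.starProjection (a i) ∈ U :=
      hm (Submodule.mem_map_of_mem (hV ▸ Submodule.subset_span ⟨i, rfl⟩))
    have h3 : U.starProjection (W.starProjection (a i)) = U.starProjection (a i) :=
      DFunLike.congr_fun (Submodule.starProjection_comp_starProjection_of_le h) (a i)
    rw [← h3, Submodule.starProjection_eq_self_iff.2 h2]
  rw [h1]

/-! ### The spherical triangle inequality and angle addition -/

section Sphere

variable {H : Type*} [NormedAddCommGroup H] [InnerProductSpace 𝕜 H]

/-- The vector on the left vanishes when β lies on a great-circle arc from α to γ, at angle θ from α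
and φ from γ. Its norm measures the slack in the triangle inequality, so equality there yields a
linear relation. -/
theorem norm_sq_sin_smul_add_sub {α β γ : H} (hα : ‖α‖ = 1) (hβ : ‖β‖ = 1) (hγ : ‖γ‖ = 1)
    {θ φ : ℝ} (h1 : RCLike.re (inner 𝕜 α β) = Real.cos θ)
    (h2 : RCLike.re (inner 𝕜 β γ) = Real.cos φ) :
    ‖((Real.sin φ : ℝ) : 𝕜) • α + ((Real.sin θ : ℝ) : 𝕜) • γ -
      ((Real.sin (θ + φ) : ℝ) : 𝕜) • β‖ ^ 2 =
      2 * Real.sin φ * Real.sin θ * (RCLike.re (inner 𝕜 α γ) - Real.cos (θ + φ)) := by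
  have h3 : RCLike.re (inner 𝕜 γ β) = Real.cos φ := by rw [inner_re_symm, h2]
  rw [norm_sub_sq (𝕜 := 𝕜), norm_add_sq (𝕜 := 𝕜)]
  simp only [norm_smul, inner_add_left, inner_smul_left, inner_smul_right, RCLike.conj_ofReal,
    map_add, RCLike.re_ofReal_mul, h1, h3, hα, hβ, hγ, RCLike.norm_ofReal, mul_one, sq_abs]
  have hs := Real.sin_sq_add_cos_sq θ
  have hs' := Real.sin_sq_add_cos_sq φ
  rw [Real.sin_add, Real.cos_add]
  linear_combination (-Real.sin φ ^ 2) * hs + (-Real.sin θ ^ 2) * hs'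

/-- The spherical triangle inequality. -/
theorem cos_add_le_re_inner {α β γ : H} (hα : ‖α‖ = 1) (hβ : ‖β‖ = 1) (hγ : ‖γ‖ = 1)
    {θ φ : ℝ} (h1 : inner 𝕜 α β = ((Real.cos θ : ℝ) : 𝕜))
    (h2 : inner 𝕜 β γ = ((Real.cos φ : ℝ) : 𝕜))
    (hθ : 0 < Real.sin θ) (hφ0 : 0 ≤ φ) (hφ : φ < Real.pi) :
    Real.cos (θ + φ) ≤ RCLike.re (inner 𝕜 α γ) := by
  -- At φ = 0 the identity carries a factor sin φ = 0 and says nothing, but then β = γ.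
  rcases hφ0.eq_or_lt with rfl | h0
  · rw [Real.cos_zero, RCLike.ofReal_one, inner_eq_one_iff_of_norm_eq_one hβ hγ] at h2
    rw [← h2, h1, add_zero, RCLike.ofReal_re]
  · have h3 := norm_sq_sin_smul_add_sub (𝕜 := 𝕜) hα hβ hγ (θ := θ) (φ := φ) (by simp [h1])
      (by simp [h2])
    have h4 := Real.sin_pos_of_pos_of_lt_pi h0 hφ
    by_contra! hlt
    have h5 : 2 * Real.sin φ * Real.sin θ * (RCLike.re (inner 𝕜 α γ) - Real.cos (θ + φ)) < 0 :=
      mul_neg_of_pos_of_neg (by positivity) (by linarith)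
    rw [← h3] at h5
    exact absurd h5 (not_lt.2 (sq_nonneg _))

end Sphere

/-- Plane geometry for u = κv + λw, with N, M, L the lengths of v, w, u and ρ = ⟨v, w⟩: u lies
between v and w, so the angles add. The quantity `D` is the area of the parallelogram on v and w,
and gives the sines. -/
theorem arccos_eq_arccos_add_arccos {N M L κ l ρ : ℝ} (hN : 0 < N) (hM : 0 < M) (hL : 0 < L)
    (hκ : 0 < κ) (hl : 0 < l) (hρ : 0 ≤ ρ) (hρ' : ρ ≤ N * M)
    (h : L ^ 2 = κ ^ 2 * N ^ 2 + l ^ 2 * M ^ 2 + 2 * κ * l * ρ) :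
    Real.arccos (ρ / (N * M)) = Real.arccos ((κ * N ^ 2 + l * ρ) / (N * L)) +
      Real.arccos ((κ * ρ + l * M ^ 2) / (L * M)) := by
  have hD : 0 ≤ (N * M) ^ 2 - ρ ^ 2 := sub_nonneg.2 (by gcongr)
  set D := √((N * M) ^ 2 - ρ ^ 2) with hD_def
  have hD2 : D ^ 2 = (N * M) ^ 2 - ρ ^ 2 := Real.sq_sqrt hD
  set x := (κ * N ^ 2 + l * ρ) / (N * L) with hx
  set y := (κ * ρ + l * M ^ 2) / (L * M) with hy
  have hx0 : 0 ≤ x := by positivity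
  have hy0 : 0 ≤ y := by positivity
  have hx1 : 1 - x ^ 2 = (l * D / (N * L)) ^ 2 := by
    rw [hx]; field_simp; rw [hD2, h]; ring
  have hy1 : 1 - y ^ 2 = (κ * D / (L * M)) ^ 2 := by
    rw [hy]; field_simp; rw [hD2, h]; ring
  have hD0 : 0 ≤ D := Real.sqrt_nonneg _
  refine Real.injOn_cos ⟨Real.arccos_nonneg _, Real.arccos_le_pi _⟩
    ⟨add_nonneg (Real.arccos_nonneg _) (Real.arccos_nonneg _), ?_⟩ ?_
  · linarith [Real.arccos_le_pi_div_two.2 hx0, Real.arccos_le_pi_div_two.2 hy0]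
  · rw [Real.cos_add, Real.sin_arccos, Real.sin_arccos, hx1, hy1, Real.sqrt_sq (by positivity),
      Real.sqrt_sq (by positivity), Real.cos_arccos, Real.cos_arccos, Real.cos_arccos, hx, hy]
    · field_simp
      rw [hD2, h]
      ring
    · linarith
    · nlinarith [sq_nonneg (κ * D / (L * M))]
    · linarith
    · nlinarith [sq_nonneg (l * D / (N * L))]
    · exact le_trans (by norm_num) (by positivity : 0 ≤ ρ / (N * M))
    · rw [div_le_one (by positivity)]; exact hρ'

/-! ### From equality of distances to a relation between multivectors -/

theorem inner_wedge_starProjection {k : ℕ} (W : Submodule 𝕜 E) (x y : Fin k → E) :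
    inner 𝕜 (wedge 𝕜 k x) (wedge 𝕜 k fun i => W.starProjection (y i)) =
      inner 𝕜 (wedge 𝕜 k fun i => W.starProjection (x i))
        (wedge 𝕜 k fun i => W.starProjection (y i)) := by
  rw [inner_wedge, inner_wedge]
  congr 1
  ext i j
  simp only [Matrix.of_apply]
  rw [inner_starProjection_starProjection, Submodule.inner_starProjection_left_eq_right]

theorem norm_wedge_starProjection {k : ℕ} {b : Fin k → E} (hb : LinearIndependent 𝕜 b)
    (W : Submodule 𝕜 E) : ‖wedge 𝕜 k fun i => W.starProjection (b i)‖ =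
      cosFS (Submodule.span 𝕜 (Set.range b)) W * ‖wedge 𝕜 k b‖ := by
  obtain ⟨e, he, hbe⟩ := exists_orthonormal_span_eq_of_finrank
    (V := Submodule.span 𝕜 (Set.range b)) (k := k)
    (by rw [finrank_span_eq_card hb, Fintype.card_fin])
  obtain ⟨t, ht⟩ := exists_wedge_map_eq_smul (x := b) he.linearIndependent
    fun i => hbe ▸ Submodule.subset_span ⟨i, rfl⟩
  have h1 := ht LinearMap.id
  have h2 := ht (W.starProjection : E →ₗ[𝕜] E)
  simp only [LinearMap.id_apply] at h1
  simp only [ContinuousLinearMap.coe_coe] at h2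
  rw [cosFS_eq_norm_wedge he hbe, h1, h2, norm_smul, norm_smul, norm_wedge_of_orthonormal he,
    mul_one, mul_comm]

theorem vecCons_add_smul_wedge {k : ℕ} (v w : E) (e : Fin k → E) (κ l : 𝕜) :
    wedge 𝕜 (k + 1) (Matrix.vecCons (κ • v + l • w) e) =
      κ • wedge 𝕜 (k + 1) (Matrix.vecCons v e) + l • wedge 𝕜 (k + 1) (Matrix.vecCons w e) := by
  have h2 (t : E) : Function.update (Matrix.vecCons 0 e) 0 t = Matrix.vecCons t e := by
    ext i; refine Fin.cases ?_ (fun i => ?_) i <;> simp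
  rw [← h2, ← h2 v, ← h2 w, (wedge 𝕜 (k + 1)).map_update_add, (wedge 𝕜 (k + 1)).map_update_smul,
    (wedge 𝕜 (k + 1)).map_update_smul]

/-- If a combination of two decomposable multivectors is decomposable, then their subspaces meet
in codimension one. -/
theorem finrank_inf_add_one_of_wedge_eq {k : ℕ} {a b c : Fin k → E} {κ l : 𝕜}
    (ha : wedge 𝕜 k a ≠ 0) (hb : wedge 𝕜 k b ≠ 0) (hc : wedge 𝕜 k c ≠ 0)
    (hκ : κ ≠ 0) (h : κ • wedge 𝕜 k a + l • wedge 𝕜 k c = wedge 𝕜 k b)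
    (hab : Submodule.span 𝕜 (Set.range b) ≠ Submodule.span 𝕜 (Set.range a)) :
    finrank 𝕜 (Submodule.span 𝕜 (Set.range a) ⊓ Submodule.span 𝕜 (Set.range c) :
      Submodule 𝕜 E) + 1 = k := by
  have hfin {x : Fin k → E} (hx : wedge 𝕜 k x ≠ 0) :
      finrank 𝕜 (Submodule.span 𝕜 (Set.range x)) = k := by
    rw [finrank_span_eq_card (wedge_ne_zero_iff.1 hx), Fintype.card_fin]
  have hle : ¬ Submodule.span 𝕜 (Set.range b) ≤ Submodule.span 𝕜 (Set.range a) := fun hle =>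
    hab (Submodule.eq_of_le_of_finrank_eq hle (by rw [hfin hb, hfin ha]))
  obtain ⟨u, hub, hua⟩ := SetLike.not_le_iff_exists.1 hle
  -- For z in the span of `c`, multiplying the relation by z kills the `c` term. So z ∧ b is a
  -- multiple of z ∧ a, u lies in the span of z and `a`, and the two vectors can be exchanged.
  have hcu : Submodule.span 𝕜 (Set.range c) ≤
      Submodule.span 𝕜 {u} ⊔ Submodule.span 𝕜 (Set.range a) := by
    intro z hz
    by_cases hza : z ∈ Submodule.span 𝕜 (Set.range a)
    · exact Submodule.mem_sup_right hza
    obtain ⟨L, hL⟩ := exists_wedge_cons (𝕜 := 𝕜) z k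
    have h1 : wedge 𝕜 (k + 1) (Matrix.vecCons z a) ≠ 0 :=
      wedge_ne_zero_iff.2 (linearIndependent_finCons.2 ⟨wedge_ne_zero_iff.1 ha, hza⟩)
    have h2 : wedge 𝕜 (k + 1) (Matrix.vecCons z c) = 0 := by
      rw [← not_ne_iff, wedge_ne_zero_iff]
      exact fun hl => (linearIndependent_finCons.1 hl).2 hz
    have h3 : wedge 𝕜 (k + 1) (Matrix.vecCons z b) =
        κ • wedge 𝕜 (k + 1) (Matrix.vecCons z a) := by
      rw [hL, ← h, map_add, map_smul, map_smul, ← hL, ← hL, h2, smul_zero, add_zero]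
    have h4 := span_le_span_of_wedge_eq_smul h3 (by rw [h3]; exact smul_ne_zero hκ h1)
    rw [span_range_vecCons, span_range_vecCons] at h4
    have h5 := h4 (Submodule.mem_sup_right hub)
    rw [← Submodule.span_union, Set.singleton_union] at h5 ⊢
    exact mem_span_insert_exchange h5 hua
  have h1 := Submodule.finrank_sup_add_finrank_inf_eq (Submodule.span 𝕜 (Set.range a))
    (Submodule.span 𝕜 (Set.range c))
  rw [hfin ha, hfin hc] at h1
  have h2 := Submodule.finrank_mono (sup_le (le_sup_right :
    Submodule.span 𝕜 (Set.range a) ≤ Submodule.span 𝕜 {u} ⊔ _) hcu)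
  have h3 := Submodule.finrank_add_le_finrank_add_finrank (Submodule.span 𝕜 {u})
    (Submodule.span 𝕜 (Set.range a))
  have h4 : finrank 𝕜 (Submodule.span 𝕜 {u}) ≤ 1 := by
    simpa using finrank_span_le_card (R := 𝕜) ({u} : Set E)
  rw [hfin ha] at h3
  -- Equal spans for `a` and `c` would make all three multivectors proportional.
  have h5 : finrank 𝕜 (Submodule.span 𝕜 (Set.range a) ⊓ Submodule.span 𝕜 (Set.range c) :
      Submodule 𝕜 E) ≠ k := by
    intro h0
    have h6 := inf_eq_left.1 (Submodule.eq_of_le_of_finrank_eq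
      (inf_le_left : Submodule.span 𝕜 (Set.range a) ⊓ Submodule.span 𝕜 (Set.range c) ≤ _)
      (by rw [h0, hfin ha]))
    have h7 := Submodule.eq_of_le_of_finrank_eq h6 (by rw [hfin ha, hfin hc])
    obtain ⟨t, ht⟩ := exists_wedge_eq_smul (x := c) (wedge_ne_zero_iff.1 ha)
      fun i => h7 ▸ Submodule.subset_span ⟨i, rfl⟩
    rw [ht, smul_smul, ← add_smul] at h
    exact hab (span_eq_span_of_wedge_eq_smul h.symm hb)
  have h6 := Submodule.finrank_mono
    (inf_le_left : Submodule.span 𝕜 (Set.range a) ⊓ Submodule.span 𝕜 (Set.range c) ≤ _)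
  rw [hfin ha] at h6
  omega

/-- The linear relation between decomposable multivectors when the triangle inequality for the
asymmetric Fubini-Study metric is a nontrivial equality. -/
theorem wedge_relation {k : ℕ} {a : Fin k → E} {U V W : Submodule 𝕜 E} (ha : Orthonormal 𝕜 a)
    (hV : Submodule.span 𝕜 (Set.range a) = V) (h : dFS V W = dFS V U + dFS U W)
    (h1 : 0 < dFS V U) (h2 : 0 < dFS U W) :
    wedge 𝕜 k (fun i => U.starProjection (a i)) ≠ 0 ∧
    wedge 𝕜 k (fun i => W.starProjection (U.starProjection (a i))) ≠ 0 ∧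
    cosFS (V.map (U.starProjection : E →ₗ[𝕜] E)) W ≠ 0 ∧
    cosFS U W = cosFS (V.map (U.starProjection : E →ₗ[𝕜] E)) W ∧
    inner 𝕜 (wedge 𝕜 k a) (wedge 𝕜 k (fun i => W.starProjection (U.starProjection (a i)))) =
      ((cosFS V W * ‖wedge 𝕜 k (fun i => W.starProjection (U.starProjection (a i)))‖ : ℝ) : 𝕜) ∧
    ∃ κ l : ℝ, 0 < κ ∧ 0 < l ∧ (κ : 𝕜) • wedge 𝕜 k a +
      (l : 𝕜) • wedge 𝕜 k (fun i => W.starProjection (U.starProjection (a i))) =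
      wedge 𝕜 k (fun i => U.starProjection (a i)) := by
  set b := fun i => U.starProjection (a i) with hb_def
  set c := fun i => W.starProjection (b i) with hc_def
  set θ := dFS V U with hθ
  set φ₀ := dFS U W with hφ₀
  have hVW : θ + φ₀ ≤ Real.pi / 2 := by
    rw [← h, dFS_eq_arccos]
    exact Real.arccos_le_pi_div_two.2 (cosFS_nonneg _ _)
  have hcos (X Y : Submodule 𝕜 E) : Real.cos (dFS X Y) = cosFS X Y := by
    rw [dFS_eq_arccos]
    exact Real.cos_arccos (by linarith [cosFS_nonneg X Y]) (cosFS_le_one X Y)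
  have hcb : Real.cos θ = ‖wedge 𝕜 k b‖ := by rw [hθ, hcos, cosFS_eq_norm_wedge ha hV]
  have hb : 0 < ‖wedge 𝕜 k b‖ := hcb ▸ Real.cos_pos_of_mem_Ioo ⟨by linarith, by linarith⟩
  have hcU : 0 < cosFS U W := by
    rw [← hcos]; exact Real.cos_pos_of_mem_Ioo ⟨by linarith, by linarith⟩
  -- `U` may have larger dimension than `V`; its subspace P_U(V) has dimension `k` and is no farther
  -- from `W`.
  set V₁ := V.map (U.starProjection : E →ₗ[𝕜] E) with hV₁_def
  have hV₁ : V₁ = Submodule.span 𝕜 (Set.range b) := map_starProjection_eq_span hV U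
  have hV₁U : V₁ ≤ U := by
    rw [hV₁, Submodule.span_le]
    rintro _ ⟨i, rfl⟩
    exact Submodule.starProjection_apply_mem _ _
  have hle := cosFS_anti_left W hV₁U
  have hV₁W : 0 < cosFS V₁ W := hcU.trans_le hle
  have hcn : ‖wedge 𝕜 k c‖ = cosFS V₁ W * ‖wedge 𝕜 k b‖ := by
    rw [hV₁]
    exact norm_wedge_starProjection (wedge_ne_zero_iff.1 (norm_pos_iff.1 hb)) W
  have hc : 0 < ‖wedge 𝕜 k c‖ := hcn ▸ mul_pos hV₁W hb
  set φ := dFS V₁ W with hφ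
  have hφle : φ ≤ φ₀ := by
    rw [hφ, hφ₀, dFS_eq_arccos, dFS_eq_arccos]
    exact Real.arccos_le_arccos hle
  have hφ0 : 0 ≤ φ := by rw [hφ, dFS_eq_arccos]; exact Real.arccos_nonneg _
  set α := wedge 𝕜 k a
  set β := ((‖wedge 𝕜 k b‖⁻¹ : ℝ) : 𝕜) • wedge 𝕜 k b with hβ_def
  set γ := ((‖wedge 𝕜 k c‖⁻¹ : ℝ) : 𝕜) • wedge 𝕜 k c with hγ_def
  have hα : ‖α‖ = 1 := norm_wedge_of_orthonormal ha
  have hβ : ‖β‖ = 1 := by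
    rw [hβ_def, norm_smul, RCLike.norm_ofReal, abs_of_nonneg (by positivity),
      inv_mul_cancel₀ hb.ne']
  have hγ : ‖γ‖ = 1 := by
    rw [hγ_def, norm_smul, RCLike.norm_ofReal, abs_of_nonneg (by positivity),
      inv_mul_cancel₀ hc.ne']
  have hαβ : inner 𝕜 α β = ((Real.cos θ : ℝ) : 𝕜) := by
    rw [hβ_def, inner_smul_right, inner_wedge_starProjection, inner_self_eq_norm_sq_to_K, hcb,
      ← RCLike.ofReal_pow, ← RCLike.ofReal_mul]
    congr 1
    change ‖wedge 𝕜 k b‖⁻¹ * ‖wedge 𝕜 k b‖ ^ 2 = _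
    field_simp
  have hβγ : inner 𝕜 β γ = ((Real.cos φ : ℝ) : 𝕜) := by
    rw [hβ_def, hγ_def, inner_smul_right, inner_smul_left, RCLike.conj_ofReal,
      inner_wedge_starProjection, inner_self_eq_norm_sq_to_K, hφ, hcos,
      ← RCLike.ofReal_pow, ← RCLike.ofReal_mul, ← RCLike.ofReal_mul]
    congr 1
    change ‖wedge 𝕜 k c‖⁻¹ * (‖wedge 𝕜 k b‖⁻¹ * ‖wedge 𝕜 k c‖ ^ 2) = _
    rw [hcn]
    field_simp
  have hsθ : 0 < Real.sin θ := Real.sin_pos_of_pos_of_lt_pi h1 (by linarith)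
  -- This begins the chain cos(θ + φ₀) ≤ cos(θ + φ) ≤ Re⟨α, γ⟩ ≤ |⟨α, γ⟩| ≤ `cosFS V W`, whose ends
  -- agree by hypothesis. Hence φ = φ₀, ⟨α, γ⟩ is real and the triangle inequality is sharp.
  have hle1 := cos_add_le_re_inner hα hβ hγ hαβ hβγ hsθ hφ0 (by linarith)
  have hle2 : Real.cos (θ + φ₀) ≤ Real.cos (θ + φ) :=
    Real.cos_le_cos_of_nonneg_of_le_pi (by linarith) (by linarith) (by linarith)
  have hγα : ‖inner 𝕜 α γ‖ ≤ cosFS V W := by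
    rw [hγ_def, inner_smul_right, norm_mul, RCLike.norm_ofReal, abs_of_nonneg (by positivity),
      inner_wedge_starProjection, cosFS_eq_norm_wedge ha hV W, inv_mul_le_iff₀ hc, mul_comm]
    exact norm_inner_le_norm _ _
  have hcVW : Real.cos (θ + φ₀) = cosFS V W := by rw [← h, hcos]
  have hre := RCLike.re_le_norm (inner 𝕜 α γ)
  have hreal : RCLike.re (inner 𝕜 α γ) = cosFS V W := by linarith
  have hφφ : φ = φ₀ := by
    have := Real.injOn_cos (x₁ := θ + φ) (x₂ := θ + φ₀) ⟨by linarith, by linarith⟩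
      ⟨by linarith, by linarith⟩ (by linarith)
    linarith
  have hαγ : inner 𝕜 α γ = ((cosFS V W : ℝ) : 𝕜) := by
    rw [← hreal, RCLike.re_eq_self_of_le (by linarith)]
  have hcγ : wedge 𝕜 k c = ((‖wedge 𝕜 k c‖ : ℝ) : 𝕜) • γ := by
    rw [hγ_def, smul_smul, ← RCLike.ofReal_mul, mul_inv_cancel₀ hc.ne', RCLike.ofReal_one,
      one_smul]
  have hbβ : wedge 𝕜 k b = ((‖wedge 𝕜 k b‖ : ℝ) : 𝕜) • β := by
    rw [hβ_def, smul_smul, ← RCLike.ofReal_mul, mul_inv_cancel₀ hb.ne', RCLike.ofReal_one,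
      one_smul]
  refine ⟨norm_pos_iff.1 hb, norm_pos_iff.1 hc, hV₁W.ne', ?_, ?_, ?_⟩
  · rw [← hcos, ← hcos, ← hφ₀, ← hφφ]
  · nth_rw 1 [hcγ]
    rw [inner_smul_right, hαγ, ← RCLike.ofReal_mul, mul_comm]
  · have h3 := norm_sq_sin_smul_add_sub (𝕜 := 𝕜) hα hβ hγ (θ := θ) (φ := φ) (by simp [hαβ])
      (by simp [hβγ])
    rw [hreal, hφφ, hcVW, sub_self, mul_zero, sq_eq_zero_iff, norm_eq_zero, sub_eq_zero] at h3
    have hsφ : 0 < Real.sin φ₀ := Real.sin_pos_of_pos_of_lt_pi h2 (by linarith)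
    have hs : 0 < Real.sin (θ + φ₀) := Real.sin_pos_of_pos_of_lt_pi (by linarith) (by linarith)
    set s := Real.sin (θ + φ₀)
    set B := ‖wedge 𝕜 k b‖
    set C := ‖wedge 𝕜 k c‖
    refine ⟨B / s * Real.sin φ₀, B / s * Real.sin θ * C⁻¹, by positivity, by positivity, ?_⟩
    have h4 : β = ((s⁻¹ : ℝ) : 𝕜) • (((Real.sin φ₀ : ℝ) : 𝕜) • α +
        ((Real.sin θ : ℝ) : 𝕜) • γ) := by
      rw [h3, smul_smul, ← RCLike.ofReal_mul, inv_mul_cancel₀ hs.ne', RCLike.ofReal_one, one_smul]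
    rw [hbβ, h4, hγ_def, smul_add, smul_add]
    simp only [smul_smul, ← RCLike.ofReal_mul]
    rw [show B / s * Real.sin φ₀ = B * (s⁻¹ * Real.sin φ₀) by ring,
      show B / s * Real.sin θ * C⁻¹ = B * (s⁻¹ * (Real.sin θ * C⁻¹)) by ring]

/-! ### Equality criteria for distances between nested subspaces -/

theorem dFS_eq_zero_iff {V W : Submodule 𝕜 E} : dFS V W = 0 ↔ V ≤ W := by
  rw [dFS_eq_arccos, Real.arccos_eq_zero]
  exact ⟨fun h => le_of_cosFS_eq_one (le_antisymm (cosFS_le_one V W) h),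
    fun h => (cosFS_of_le h).ge⟩

theorem dFS_nonneg (V W : Submodule 𝕜 E) : 0 ≤ dFS V W := by
  rw [dFS_eq_arccos]
  exact Real.arccos_nonneg _

theorem dFS_eq_dFS_iff {V W V' W' : Submodule 𝕜 E} :
    dFS V W = dFS V' W' ↔ cosFS V W = cosFS V' W' := by
  rw [dFS_eq_arccos, dFS_eq_arccos, Real.arccos_inj (by linarith [cosFS_nonneg V W])
    (cosFS_le_one _ _) (by linarith [cosFS_nonneg V' W']) (cosFS_le_one _ _)]

theorem dFS_eq_dFS_iff_of_le_right {V U W : Submodule 𝕜 E} (h : U ≤ W) :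
    dFS V W = dFS V U ↔
      PartiallyOrthogonal V W ∨ V.map (W.starProjection : E →ₗ[𝕜] E) ≤ U := by
  rw [dFS_eq_dFS_iff, ← cosFS_eq_zero_iff]
  constructor
  · intro heq
    by_cases h0 : cosFS V W = 0
    · exact Or.inl h0
    · exact Or.inr (map_starProjection_le_of_cosFS_eq h h0 heq)
  · rintro (h0 | hm)
    · exact le_antisymm (h0 ▸ cosFS_nonneg V U) (cosFS_mono_right V h)
    · exact cosFS_eq_of_map_starProjection_le h hm

theorem dFS_eq_dFS_iff_of_le_left {V U W : Submodule 𝕜 E} (h : V ≤ U) :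
    dFS V W = dFS U W ↔ PartiallyOrthogonal V W ∨ Vᗮ ⊓ U ≤ W := by
  rw [dFS_eq_dFS_iff, ← cosFS_eq_zero_iff]
  constructor
  · intro heq
    by_cases h0 : cosFS V W = 0
    · exact Or.inl h0
    · exact Or.inr (orthogonal_inf_le_of_cosFS_eq h h0 heq.symm)
  · rintro (h0 | hm)
    · exact le_antisymm (h0 ▸ cosFS_nonneg U W) (cosFS_anti_left W h)
    · exact (cosFS_eq_of_orthogonal_inf_le h hm).symm

/-! ### Aligned configurations give additive distances -/

theorem starProjection_span_singleton_sup {S : Submodule 𝕜 E} {u v : E} (hu : u ∈ Sᗮ)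
    (hv : v ∈ Sᗮ) (hu0 : u ≠ 0) :
    (Submodule.span 𝕜 {u} ⊔ S).starProjection v = (inner 𝕜 u v / ((‖u‖ ^ 2 : ℝ) : 𝕜)) • u := by
  have hmem : (inner 𝕜 u v / ((‖u‖ ^ 2 : ℝ) : 𝕜)) • u ∈ Submodule.span 𝕜 {u} ⊔ S :=
    Submodule.mem_sup_left (Submodule.smul_mem _ _ (Submodule.mem_span_singleton_self u))
  refine Submodule.eq_starProjection_of_mem_orthogonal hmem ?_
  rw [← Submodule.inf_orthogonal]
  refine Submodule.mem_inf.2 ⟨?_, Submodule.sub_mem _ hv (Submodule.smul_mem _ _ hu)⟩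
  rw [Submodule.mem_orthogonal_singleton_iff_inner_right, inner_sub_right,
    inner_smul_right, inner_self_eq_norm_sq_to_K, ← RCLike.ofReal_pow, div_mul_cancel₀, sub_self]
  have := norm_pos_iff.2 hu0
  exact_mod_cast (by positivity : ‖u‖ ^ 2 ≠ 0)

/-- `R` is left fixed and contributes the factor 1, so only the angle between the lines [v] and [u]
remains. -/
theorem cosFS_span_singleton_sup_span_singleton_sup {R S : Submodule 𝕜 E} {u v : E} (hRS : R ≤ S)
    (hu : u ∈ Sᗮ) (hv : v ∈ Sᗮ) (hu0 : u ≠ 0) (hv0 : v ≠ 0) :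
    cosFS (Submodule.span 𝕜 {v} ⊔ R) (Submodule.span 𝕜 {u} ⊔ S) =
      ‖(inner 𝕜 u v : 𝕜)‖ / (‖v‖ * ‖u‖) := by
  have hvn := norm_pos_iff.2 hv0
  have hun := norm_pos_iff.2 hu0
  set y := ((‖v‖⁻¹ : ℝ) : 𝕜) • v with hy_def
  have hc : ((‖v‖⁻¹ : ℝ) : 𝕜) ≠ 0 := by exact_mod_cast (inv_pos.2 hvn).ne'
  have hy : ‖y‖ = 1 := by
    rw [hy_def, norm_smul, RCLike.norm_ofReal, abs_of_nonneg (by positivity),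
      inv_mul_cancel₀ hvn.ne']
  have hyS : y ∈ Sᗮ := Submodule.smul_mem _ _ hv
  have hspan : Submodule.span 𝕜 {v} = Submodule.span 𝕜 {y} :=
    (Submodule.span_singleton_smul_eq (IsUnit.mk0 _ hc) v).symm
  have hR := Submodule.orthogonal_le hRS
  have hP := starProjection_span_singleton_sup hu hyS hu0
  rw [hspan, cosFS_span_singleton_sup hy (hR hyS)
    (by rw [hP]; exact Submodule.smul_mem _ _ (hR hu)),
    cosFS_of_le (hRS.trans le_sup_right), hP, mul_one, norm_smul, norm_div, hy_def,
    inner_smul_right, norm_mul, RCLike.norm_ofReal, RCLike.norm_ofReal,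
    abs_of_nonneg (by positivity), abs_of_nonneg (by positivity)]
  field_simp

omit [FiniteDimensional 𝕜 E] in
theorem Aligned.inner_eq_norm {u v : E} (h : Aligned 𝕜 u v) :
    inner 𝕜 u v = ((‖(inner 𝕜 u v : 𝕜)‖ : ℝ) : 𝕜) := by
  have h1 : (inner 𝕜 u v : 𝕜) = ((RCLike.re (inner 𝕜 u v : 𝕜) : ℝ) : 𝕜) := by
    rw [← RCLike.re_add_im (inner 𝕜 u v : 𝕜), h.2]
    simp
  have h2 : ‖(inner 𝕜 u v : 𝕜)‖ = RCLike.re (inner 𝕜 u v : 𝕜) := by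
    nth_rw 1 [h1]
    rw [RCLike.norm_ofReal, abs_of_nonneg h.1]
  rw [h2]
  exact h1

omit [FiniteDimensional 𝕜 E] in
theorem aligned_of_inner_eq {u v : E} {r : ℝ} (hr : 0 ≤ r) (h : inner 𝕜 u v = (r : 𝕜)) :
    Aligned 𝕜 u v := by
  simp [Aligned, h, hr]

theorem dFS_add_of_aligned {R S T : Submodule 𝕜 E} {u v w : E} {κ l : ℝ} (hRS : R ≤ S)
    (hST : S ≤ T) (hu : u ∈ Tᗮ) (hv : v ∈ Tᗮ) (hw : w ∈ Tᗮ) (hu0 : u ≠ 0) (hv0 : v ≠ 0)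
    (hw0 : w ≠ 0) (hvw : Aligned 𝕜 v w) (hκ : 0 < κ) (hl : 0 < l)
    (h : u = (κ : 𝕜) • v + (l : 𝕜) • w) :
    dFS (Submodule.span 𝕜 {v} ⊔ R) (Submodule.span 𝕜 {w} ⊔ T) =
      dFS (Submodule.span 𝕜 {v} ⊔ R) (Submodule.span 𝕜 {u} ⊔ S) +
      dFS (Submodule.span 𝕜 {u} ⊔ S) (Submodule.span 𝕜 {w} ⊔ T) := by
  have hT := Submodule.orthogonal_le hST
  rw [dFS_eq_arccos, dFS_eq_arccos, dFS_eq_arccos,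
    cosFS_span_singleton_sup_span_singleton_sup (hRS.trans hST) hw hv hw0 hv0,
    cosFS_span_singleton_sup_span_singleton_sup hRS (hT hu) (hT hv) hu0 hv0,
    cosFS_span_singleton_sup_span_singleton_sup hST hw hu hw0 hu0]
  set ρ := ‖(inner 𝕜 v w : 𝕜)‖ with hρ
  have h1 : inner 𝕜 v w = (ρ : 𝕜) := hvw.inner_eq_norm
  have h2 : inner 𝕜 w v = (ρ : 𝕜) := by rw [← inner_conj_symm, h1, RCLike.conj_ofReal]
  have h3 : inner 𝕜 u v = ((κ * ‖v‖ ^ 2 + l * ρ : ℝ) : 𝕜) := by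
    rw [h, inner_add_left, inner_smul_left, inner_smul_left, h2, inner_self_eq_norm_sq_to_K]
    simp
  have h4 : inner 𝕜 w u = ((κ * ρ + l * ‖w‖ ^ 2 : ℝ) : 𝕜) := by
    rw [h, inner_add_right, inner_smul_right, inner_smul_right, h2, inner_self_eq_norm_sq_to_K]
    simp
  have h5 : ‖u‖ ^ 2 = κ ^ 2 * ‖v‖ ^ 2 + l ^ 2 * ‖w‖ ^ 2 + 2 * κ * l * ρ := by
    rw [h, norm_add_sq (𝕜 := 𝕜), inner_smul_left, inner_smul_right, h1, norm_smul, norm_smul,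
      RCLike.conj_ofReal, ← RCLike.ofReal_mul, ← RCLike.ofReal_mul, RCLike.ofReal_re,
      RCLike.norm_ofReal, RCLike.norm_ofReal, abs_of_pos hκ, abs_of_pos hl]
    ring
  rw [h2, h3, h4, RCLike.norm_ofReal, RCLike.norm_ofReal, RCLike.norm_ofReal,
    abs_of_nonneg (by positivity), abs_of_nonneg (by positivity), abs_of_nonneg (by positivity)]
  exact arccos_eq_arccos_add_arccos (norm_pos_iff.2 hv0) (norm_pos_iff.2 hw0) (norm_pos_iff.2 hu0)
    hκ hl (norm_nonneg _) (norm_inner_le_norm v w) h5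

/-! ### Extracting the aligned configuration -/

/-- A unit vector completing a subspace of codimension one. -/
theorem exists_unit_span_singleton_sup {R V : Submodule 𝕜 E} (h : R ≤ V)
    (hf : finrank 𝕜 R + 1 = finrank 𝕜 V) :
    ∃ v, ‖v‖ = 1 ∧ v ∈ Rᗮ ∧ v ∈ V ∧ Submodule.span 𝕜 {v} ⊔ R = V := by
  obtain ⟨v, hv, hvR, hvV⟩ := exists_unit_mem_orthogonal
    (lt_of_le_of_ne h fun h0 => by rw [h0] at hf; omega)
  refine ⟨v, hv, hvR, hvV, Submodule.eq_of_le_of_finrank_eq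
    (sup_le ((Submodule.span_singleton_le_iff_mem v V).2 hvV) h) ?_⟩
  obtain ⟨a, -, -, ha, hs⟩ := exists_vecCons_orthonormal hv hvR
  rw [← hs, finrank_span_eq_card ha.linearIndependent, Fintype.card_fin]
  exact hf

/-- The common factor is R = V ∩ P_W(P_U(V)). The other two spaces are S = R + (P_U(V)ᗮ ∩ U) and T =
[w]ᗮ ∩ W. -/
theorem exists_aligned_of_dFS_eq_add {U V W : Submodule 𝕜 E} (h : dFS V W = dFS V U + dFS U W)
    (hVU : ¬ V ≤ U) (hUW : ¬ U ≤ W) :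
    ∃ (R S T : Submodule 𝕜 E) (u v w : E) (κ l : ℝ),
      R ≤ S ∧ S ≤ T ∧ u ∈ Tᗮ ∧ v ∈ Tᗮ ∧ w ∈ Tᗮ ∧ u ≠ 0 ∧ v ≠ 0 ∧ w ≠ 0 ∧
      Aligned 𝕜 u v ∧ Aligned 𝕜 v w ∧ Aligned 𝕜 u w ∧
      0 < κ ∧ 0 < l ∧ u = (κ : 𝕜) • v + (l : 𝕜) • w ∧
      V = Submodule.span 𝕜 {v} ⊔ R ∧ U = Submodule.span 𝕜 {u} ⊔ S ∧
      W = Submodule.span 𝕜 {w} ⊔ T := by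
  have h1 : 0 < dFS V U := (dFS_nonneg V U).lt_of_ne' (mt dFS_eq_zero_iff.1 hVU)
  have h2 : 0 < dFS U W := (dFS_nonneg U W).lt_of_ne' (mt dFS_eq_zero_iff.1 hUW)
  set V₁ := V.map (U.starProjection : E →ₗ[𝕜] E) with hV₁
  set W₁ := V₁.map (W.starProjection : E →ₗ[𝕜] E) with hW₁
  set R := V ⊓ W₁ with hR_def
  have hV₁U : V₁ ≤ U := by
    rintro _ ⟨x, -, rfl⟩
    exact Submodule.starProjection_apply_mem _ _
  have hW₁W : W₁ ≤ W := by
    rintro _ ⟨x, -, rfl⟩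
    exact Submodule.starProjection_apply_mem _ _
  -- `wedge_relation` serves twice: here, with any orthonormal basis of `V`, to find dim R; below,
  -- with a basis adapted to V = [v] ⊕ R.
  obtain ⟨hR, hfW₁⟩ : finrank 𝕜 R + 1 = finrank 𝕜 V ∧ finrank 𝕜 W₁ = finrank 𝕜 V := by
    obtain ⟨a, ha, hV⟩ := exists_orthonormal_span_eq V
    obtain ⟨hb, hc, -, -, -, κ, l, hκ, -, hrel⟩ := wedge_relation ha hV h h1 h2
    have hsb := map_starProjection_eq_span hV U
    have hsc := map_starProjection_eq_span hsb.symm W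
    have hf := finrank_inf_add_one_of_wedge_eq
      (norm_ne_zero_iff.1 (by rw [norm_wedge_of_orthonormal (𝕜 := 𝕜) ha]; exact one_ne_zero)) hb hc
      (RCLike.ofReal_ne_zero.2 hκ.ne') hrel
      (by rw [← hsb, hV]; exact fun h0 => hVU (h0 ▸ hV₁U))
    rw [hV, ← hsc] at hf
    refine ⟨hf, ?_⟩
    rw [hW₁, hV₁, hsc, finrank_span_eq_card (wedge_ne_zero_iff.1 hc), Fintype.card_fin]
  obtain ⟨v, hv, hvR, hvV, hvs⟩ := exists_unit_span_singleton_sup inf_le_left hR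
  obtain ⟨w₀, hw₀, hw₀R, hw₀W, hws⟩ := exists_unit_span_singleton_sup
    (inf_le_right : R ≤ W₁) (hR.trans hfW₁.symm)
  obtain ⟨e, he, hes, hve, hves⟩ := exists_vecCons_orthonormal hv hvR
  obtain ⟨hb, hc, hc0, hceq, hinner, κ, l, hκ, hl, hrel⟩ :=
    wedge_relation hve (hves.trans hvs) h h1 h2
  set c := fun i => W.starProjection (U.starProjection (Matrix.vecCons v e i)) with hc_def
  have hsb := map_starProjection_eq_span (hves.trans hvs) U
  have hsc := map_starProjection_eq_span hsb.symm W
  have heR (i) : e i ∈ R := hes.le (Submodule.subset_span ⟨i, rfl⟩)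
  -- Both families are bases of `W₁`; absorbing `t` into `w₀` fixes the length and phase of `w`.
  obtain ⟨t, ht⟩ : ∃ t : 𝕜, wedge 𝕜 _ c = t • wedge 𝕜 _ (Matrix.vecCons w₀ e) := by
    refine exists_wedge_eq_smul (linearIndependent_finCons.2 ⟨he.linearIndependent, ?_⟩) fun i => ?_
    · intro h0
      rw [hes] at h0
      have := Submodule.inner_right_of_mem_orthogonal h0 hw₀R
      rw [inner_self_eq_zero] at this
      simp [this] at hw₀
    · rw [span_range_vecCons, hes, hws]
      exact hsc.ge (Submodule.subset_span ⟨i, rfl⟩)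
  have ht0 : t ≠ 0 := fun h0 => hc (by rw [ht, h0, zero_smul])
  set w := t • w₀ with hw_def
  have hcw : wedge 𝕜 _ c = wedge 𝕜 _ (Matrix.vecCons w e) := by
    have := vecCons_add_smul_wedge w₀ 0 e t 0
    rw [zero_smul, zero_smul, add_zero, add_zero] at this
    rw [ht, this]
  have hwR : w ∈ Rᗮ := Submodule.smul_mem _ _ hw₀R
  have hwW₁ : w ∈ W₁ := Submodule.smul_mem _ _ hw₀W
  have hw0 : w ≠ 0 := smul_ne_zero ht0 (norm_ne_zero_iff.1 (by rw [hw₀]; exact one_ne_zero))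
  have hne := norm_wedge_of_orthonormal (𝕜 := 𝕜) he
  have hce : ‖wedge 𝕜 _ c‖ = ‖w‖ := by
    rw [hcw, norm_wedge_cons fun i => Submodule.inner_left_of_mem_orthogonal (heR i) hwR, hne,
      mul_one]
  have hvw : inner 𝕜 v w = ((cosFS V W * ‖w‖ : ℝ) : 𝕜) := by
    rw [hce, hcw, inner_wedge_cons w fun i => Submodule.inner_left_of_mem_orthogonal (heR i) hvR,
      hne] at hinner
    simpa using hinner
  set ρ := cosFS V W * ‖w‖ with hρ
  have hρ0 : 0 ≤ ρ := mul_nonneg (cosFS_nonneg _ _) (norm_nonneg _)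
  have hwv : inner 𝕜 w v = (ρ : 𝕜) := by rw [← inner_conj_symm, hvw, RCLike.conj_ofReal]
  set u := (κ : 𝕜) • v + (l : 𝕜) • w with hu_def
  have hbu : wedge 𝕜 _ (Matrix.vecCons u e) =
      wedge 𝕜 _ fun i => U.starProjection (Matrix.vecCons v e i) := by
    rw [hu_def, vecCons_add_smul_wedge, ← hcw, hrel]
  have hV₁s : V₁ = Submodule.span 𝕜 {u} ⊔ R := by
    rw [hV₁, hsb, show Submodule.span 𝕜 {u} ⊔ R = Submodule.span 𝕜 (Set.range
      (Matrix.vecCons u e)) by rw [span_range_vecCons, hes]]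
    exact span_eq_span_of_wedge_eq_smul (t := 1) (hbu.symm.trans (one_smul _ _).symm) hb
  have hu0 : u ≠ 0 := fun h0 =>
    hb (hbu ▸ (wedge 𝕜 _).map_coord_zero 0 (by simpa using h0))
  -- Since `U` and `V₁` have the same nonzero cosine to `W`, the excess of `U` over `V₁` lies in
  -- `W`.
  have hQW : V₁ᗮ ⊓ U ≤ W := orthogonal_inf_le_of_cosFS_eq hV₁U hc0 hceq
  have hwQ : ∀ q ∈ V₁ᗮ ⊓ U, inner 𝕜 w q = 0 := by
    intro q hq
    obtain ⟨x, hx, hxw⟩ := hwW₁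
    rw [← hxw]
    show inner 𝕜 (W.starProjection x) q = 0
    rw [Submodule.inner_starProjection_left_eq_right,
      Submodule.starProjection_eq_self_iff.2 (hQW hq)]
    exact Submodule.inner_right_of_mem_orthogonal hx hq.1
  set T := (Submodule.span 𝕜 {w})ᗮ ⊓ W with hT_def
  have hwT : w ∈ Tᗮ := Submodule.orthogonal_le (inf_le_left : T ≤ _)
    (Submodule.le_orthogonal_orthogonal _ (Submodule.mem_span_singleton_self w))
  have hRW : R ≤ W := inf_le_right.trans hW₁W
  have hcosv : cosFS V W = ‖W.starProjection v‖ := by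
    rw [← hvs, cosFS_span_singleton_sup hv hvR, cosFS_of_le hRW, mul_one]
    rw [Submodule.mem_orthogonal']
    intro x hx
    rw [Submodule.inner_starProjection_left_eq_right,
      Submodule.starProjection_eq_self_iff.2 (hRW hx)]
    exact Submodule.inner_left_of_mem_orthogonal hx hvR
  -- Equality in Cauchy–Schwarz: P_W v is a multiple of w, so v is orthogonal to `T`.
  have hPv : ((‖w‖ : ℝ) : 𝕜) • W.starProjection v = ((‖W.starProjection v‖ : ℝ) : 𝕜) • w := by
    rw [← inner_eq_norm_mul_iff, Submodule.inner_starProjection_left_eq_right,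
      Submodule.starProjection_eq_self_iff.2 (hW₁W hwW₁), hvw, hρ, hcosv, RCLike.ofReal_mul]
  have hvT : v ∈ Tᗮ := by
    rw [Submodule.mem_orthogonal']
    intro x hx
    have h3 := Submodule.inner_left_of_mem_orthogonal hx hwT
    have h4 : inner 𝕜 (((‖w‖ : ℝ) : 𝕜) • W.starProjection v) x = 0 := by
      rw [hPv, inner_smul_left, h3, mul_zero]
    rw [inner_smul_left, Submodule.inner_starProjection_left_eq_right,
      Submodule.starProjection_eq_self_iff.2 hx.2] at h4
    refine (mul_eq_zero.1 h4).resolve_left ?_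
    rw [RCLike.conj_ofReal]
    exact RCLike.ofReal_ne_zero.2 (norm_ne_zero_iff.2 hw0)
  have huT : u ∈ Tᗮ := Submodule.add_mem _ (Submodule.smul_mem _ _ hvT) (Submodule.smul_mem _ _ hwT)
  have huv : inner 𝕜 u v = ((κ + l * ρ : ℝ) : 𝕜) := by
    rw [hu_def, inner_add_left, inner_smul_left, inner_smul_left, hwv, inner_self_eq_norm_sq_to_K,
      hv]
    simp
  have huw : inner 𝕜 u w = ((κ * ρ + l * ‖w‖ ^ 2 : ℝ) : 𝕜) := by
    rw [hu_def, inner_add_left, inner_smul_left, inner_smul_left, hvw, inner_self_eq_norm_sq_to_K]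
    simp
  have hv0 : v ≠ 0 := norm_ne_zero_iff.1 (by rw [hv]; exact one_ne_zero)
  refine ⟨R, R ⊔ V₁ᗮ ⊓ U, T, u, v, w, κ, l, le_sup_left, sup_le (le_inf ?_ hRW) (le_inf ?_ hQW),
    huT, hvT, hwT, hu0, hv0, hw0, aligned_of_inner_eq (by positivity) huv,
    aligned_of_inner_eq hρ0 hvw, aligned_of_inner_eq (by positivity) huw, hκ, hl, rfl, hvs.symm,
    ?_, ?_⟩
  · intro x hx
    rw [Submodule.mem_orthogonal_singleton_iff_inner_right]
    exact Submodule.inner_left_of_mem_orthogonal hx hwR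
  · intro x hx
    rw [Submodule.mem_orthogonal_singleton_iff_inner_right]
    exact hwQ x hx
  · rw [← sup_assoc, ← hV₁s]
    exact (Submodule.sup_orthogonal_inf_of_hasOrthogonalProjection hV₁U).symm
  · exact (Submodule.sup_orthogonal_inf_of_hasOrthogonalProjection
      ((Submodule.span_singleton_le_iff_mem w W).2 (hW₁W hwW₁))).symm

end TotalGrassmannian

end

theorem proposition5p10 {𝕜 : Type*} [RCLike 𝕜] (n : ℕ)
    (U V W : Submodule 𝕜 (EuclideanSpace 𝕜 (Fin n))) :
    TotalGrassmannian.dFS V W = TotalGrassmannian.dFS V U + TotalGrassmannian.dFS U W ↔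
      (U ≤ W ∧ (TotalGrassmannian.PartiallyOrthogonal V W ∨
        V.map (W.starProjection : EuclideanSpace 𝕜 (Fin n) →ₗ[𝕜] EuclideanSpace 𝕜 (Fin n)) ≤ U)) ∨
      (V ≤ U ∧ (TotalGrassmannian.PartiallyOrthogonal V W ∨ Vᗮ ⊓ U ≤ W)) ∨
      (∃ (R S T : Submodule 𝕜 (EuclideanSpace 𝕜 (Fin n))) (u v w : EuclideanSpace 𝕜 (Fin n))
          (κ l : ℝ),
        R ≤ S ∧ S ≤ T ∧ u ∈ Tᗮ ∧ v ∈ Tᗮ ∧ w ∈ Tᗮ ∧ u ≠ 0 ∧ v ≠ 0 ∧ w ≠ 0 ∧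
        TotalGrassmannian.Aligned 𝕜 u v ∧ TotalGrassmannian.Aligned 𝕜 v w ∧
        TotalGrassmannian.Aligned 𝕜 u w ∧
        0 < κ ∧ 0 < l ∧ u = (κ : 𝕜) • v + (l : 𝕜) • w ∧
        V = Submodule.span 𝕜 {v} ⊔ R ∧ U = Submodule.span 𝕜 {u} ⊔ S ∧
        W = Submodule.span 𝕜 {w} ⊔ T) := by
  open TotalGrassmannian in
  constructor
  · intro h
    by_cases hUW : U ≤ W
    · rw [dFS_eq_zero_iff.2 hUW, add_zero] at h
      exact Or.inl ⟨hUW, (dFS_eq_dFS_iff_of_le_right hUW).1 h⟩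
    by_cases hVU : V ≤ U
    · rw [dFS_eq_zero_iff.2 hVU, zero_add] at h
      exact Or.inr (Or.inl ⟨hVU, (dFS_eq_dFS_iff_of_le_left hVU).1 h⟩)
    exact Or.inr (Or.inr (exists_aligned_of_dFS_eq_add h hVU hUW))
  · rintro (⟨hUW, h⟩ | ⟨hVU, h⟩ | ⟨R, S, T, u, v, w, κ, l, hRS, hST, hu, hv, hw, hu0, hv0, hw0,
      -, hvw, -, hκ, hl, h, rfl, rfl, rfl⟩)
    · rw [dFS_eq_zero_iff.2 hUW, add_zero, (dFS_eq_dFS_iff_of_le_right hUW).2 h]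
    · rw [dFS_eq_zero_iff.2 hVU, zero_add, (dFS_eq_dFS_iff_of_le_left hVU).2 h]
    · exact dFS_add_of_aligned hRS hST hu hv hw hu0 hv0 hw0 hvw hκ hl h
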